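/- Theorem. For $n\ge 0$ let $(a)_n=a(a+1)\cdots(a+n-1)$, so that $(1)_n=n!$, and let $${}_3F_2(a,b,c;d,e;z)=\sum_{n=0}^\infty\frac{(a)_n(b)_n(c)_n}{(d)_n(e)_n}\frac{z^n}{n!}.$$ Consider the two summations $$\text{(P)}\quad \sum_{n=0}^{\infty}\frac{(\frac12)_n^3}{(1)_n^3}(6n+1)\left(\frac14\right)^n=\frac4\pi,\qquad \text{(Q)}\quad \sum_{n=0}^{\infty}\frac{(\frac12)_n(\frac16)_n(\frac56)_n}{(1)_n^3}(28n+3)\left(\frac{27}{125}\right)^n=\frac{5\sqrt5}{\pi}.$$ Then (P) holds if and only if (Q) holds; moreover (Q) holds, and hence so does (P). Both series converge absolutely. These series belong to the following transformation. For every complex $x$ with $|x|\le 1$, both of the following series converge absolutely and, with the principal branch of the power, $${}_3F_2\left(\tfrac12,\tfrac12,\tfrac12;1,1;x\right)=\left(1-\frac x4\right)^{-1/2}{}_3F_2\left(\tfrac12,\tfrac16,\tfrac56;1,1;\frac{27x^2}{(4-x)^3}\right).$$ It translates the series as follows, for every real number $S$. At $x=\frac14$, where $\frac{27x^2}{(4-x)^3}=\frac4{125}$: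 $$\sum_{n=0}^{\infty}\frac{(\frac12)_n^3}{(1)_n^3}(6n+1)\left(\frac14\right)^n=S\iff \sum_{n=0}^{\infty}\frac{(\frac12)_n(\frac16)_n(\frac56)_n}{(1)_n^3}(22n+2)\left(\frac4{125}\right)^n=\frac{5\sqrt{15}}{12}\,S.$$ At $x=-1$, where $\frac{27x^2}{(4-x)^3}=\frac{27}{125}$: $$\sum_{n=0}^{\infty}\frac{(\frac12)_n^3}{(1)_n^3}(4n+1)(-1)^n=S\iff \sum_{n=0}^{\infty}\frac{(\frac12)_n(\frac16)_n(\frac56)_n}{(1)_n^3}(28n+3)\left(\frac{27}{125}\right)^n=\frac{5\sqrt5}{2}\,S.$$ (The series with $(-1)^n$ is the limit of its partial sums; the other three are absolutely convergent sums.) -/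

import Mathlib

open Filter Topology

/-- The rising factorial `(a)_n = a (a + 1) ⋯ (a + n - 1)`. -/
noncomputable def poch {K : Type*} [Field K] (a : K) (n : ℕ) : K :=
  (ascPochhammer K n).eval a

/-- The `n`-th term of the series `₃F₂(a, b, c; d, e; z)`. -/
noncomputable def hyp3F2Term (a b c d e z : ℂ) (n : ℕ) : ℂ :=
  poch a n * poch b n * poch c n / (poch d n * poch e n) * (z ^ n / (Nat.factorial n : ℂ))

/-- The coefficient `(1/2)_n (s)_n (1-s)_n / (1)_n ^ 3` shared by all the series for `1 / π`. -/
noncomputable def ramanujanCoeff (s : ℝ) (n : ℕ) : ℝ :=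
  poch (1 / 2) n * poch s n * poch (1 - s) n / poch 1 n ^ 3

/-! Expand `(1 - x/4)^(-1/2) * (27x²/(4-x)³)^k` by the binomial series. This turns the right side of
the transformation into a double series whose coefficient at `x^n` is a sum over `k` of
`cubicSummand n k`. That sum terminates, and a telescoping recurrence evaluates it as
`((1/2)_n/n!)³` (`sum_cubicSummand`). All summands are nonnegative, so the two summations may be
exchanged as soon as the left series converges absolutely. A weight `a n + b` survives the exchange
as another linear weight in `k` (`hasSum_cubic_transformation`), which translates one series for
`1/π` into another. At `x = -1` the weighted left series converges only conditionally, so that point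
is reached by Abel's theorem. The values `4/π` and `2/π` come from two WZ pairs: a parameter `k` is
added without changing the sum, then sent to infinity, where only the term `n = 0` survives and
Wallis' product evaluates it. The `2/π` series at `x = -1` gives (Q). Thus (P) and (Q) are each
proved outright, and their equivalence follows from that. The converse translations follow from
uniqueness of sums. -/

theorem poch_zero {K : Type*} [Field K] (a : K) : poch a 0 = 1 := by simp [poch]

theorem poch_succ {K : Type*} [Field K] (a : K) (n : ℕ) :
    poch a (n + 1) = poch a n * (a + n) := by
  simp [poch, ascPochhammer_succ_eval]

theorem poch_succ_left {K : Type*} [Field K] (a : K) (n : ℕ) :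
    poch a (n + 1) = a * poch (a + 1) n := by
  induction n with
  | zero => simp [poch_succ, poch_zero]
  | succ n ih => rw [poch_succ, ih, poch_succ]; push_cast; ring

theorem poch_add {K : Type*} [Field K] (a : K) (m n : ℕ) :
    poch a (m + n) = poch a m * poch (a + m) n := by
  induction n with
  | zero => simp [poch_zero]
  | succ n ih => rw [← add_assoc, poch_succ, ih, poch_succ]; push_cast; ring

theorem poch_one {K : Type*} [Field K] (n : ℕ) : poch (1 : K) n = (n.factorial : K) := by
  induction n with
  | zero => simp [poch_zero]
  | succ n ih => rw [poch_succ, ih, Nat.factorial_succ]; push_cast; ring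

theorem poch_ofReal (a : ℝ) (n : ℕ) : ((poch a n : ℝ) : ℂ) = poch (a : ℂ) n := by
  induction n with
  | zero => simp [poch_zero]
  | succ n ih => rw [poch_succ, poch_succ, ← ih]; push_cast; ring

theorem poch_pos {a : ℝ} (ha : 0 < a) (n : ℕ) : 0 < poch a n :=
  ascPochhammer_pos n a ha

/-- Triplication of `(1/2)_n`. -/
theorem poch_half_three_mul (k : ℕ) :
    poch (1 / 2 : ℝ) (3 * k) =
      27 ^ k * (poch (1 / 2) k * poch (1 / 6) k * poch (5 / 6) k) := by
  induction k with
  | zero => simp [poch_zero]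
  | succ k ih =>
    rw [show 3 * (k + 1) = 3 * k + 1 + 1 + 1 by ring]
    simp only [poch_succ]
    rw [ih]; push_cast; ring

/-! ### Central binomial ratios and Wallis' product -/

/-- The normalised central binomial coefficient `(1/2)_n / n!`. -/
noncomputable def centralRatio (n : ℕ) : ℝ := poch (1 / 2) n / n.factorial

theorem centralRatio_zero : centralRatio 0 = 1 := by simp [centralRatio, poch_zero]

theorem centralRatio_succ (n : ℕ) :
    centralRatio (n + 1) = centralRatio n * ((2 * n + 1) / (2 * n + 2)) := by
  have : (n.factorial : ℝ) ≠ 0 := by positivity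
  have : (n : ℝ) + 1 ≠ 0 := by positivity
  rw [centralRatio, centralRatio, poch_succ, Nat.factorial_succ]
  push_cast
  field_simp
  ring

theorem centralRatio_pos (n : ℕ) : 0 < centralRatio n :=
  div_pos (poch_pos (by norm_num) n) (by positivity)

theorem centralRatio_antitone : Antitone centralRatio := by
  refine antitone_nat_of_succ_le fun n => ?_
  rw [centralRatio_succ]
  refine mul_le_of_le_one_right (centralRatio_pos n).le ?_
  rw [div_le_one (by positivity)]; linarith

theorem centralRatio_le_one (n : ℕ) : centralRatio n ≤ 1 :=
  centralRatio_zero ▸ centralRatio_antitone (Nat.zero_le n)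

theorem mul_centralRatio_sq_eq_inv_wallis (n : ℕ) :
    (2 * n + 1) * centralRatio n ^ 2 = (Real.Wallis.W n)⁻¹ := by
  induction n with
  | zero => simp [centralRatio_zero, Real.Wallis.W]
  | succ n ih =>
    rw [Real.Wallis.W_succ, mul_inv, ← ih, centralRatio_succ]
    push_cast
    field_simp
    ring

theorem tendsto_mul_centralRatio_sq :
    Tendsto (fun n : ℕ => (2 * (n : ℝ) + 1) * centralRatio n ^ 2) atTop (𝓝 (2 / Real.pi)) := by
  simp_rw [mul_centralRatio_sq_eq_inv_wallis]
  have := Real.Wallis.tendsto_W_nhds_pi_div_two.inv₀ (by positivity)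
  rwa [inv_div] at this

theorem mul_centralRatio_sq_le_one (n : ℕ) : (2 * n + 1) * centralRatio n ^ 2 ≤ 1 := by
  induction n with
  | zero => simp [centralRatio_zero]
  | succ n ih =>
    refine le_trans ?_ ih
    rw [centralRatio_succ, mul_pow, mul_left_comm, mul_comm (2 * (n : ℝ) + 1)]
    refine mul_le_mul_of_nonneg_left ?_ (by positivity)
    rw [div_pow, ← mul_div_assoc, div_le_iff₀ (by positivity)]
    push_cast
    nlinarith [Nat.cast_nonneg (α := ℝ) n]

theorem tendsto_centralRatio_sq : Tendsto (fun n => centralRatio n ^ 2) atTop (𝓝 0) := by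
  refine squeeze_zero (fun n => by positivity) (fun n => ?_)
    tendsto_one_div_add_atTop_nhds_zero_nat
  rw [le_div_iff₀ (by positivity)]
  nlinarith [mul_centralRatio_sq_le_one n, mul_nonneg (Nat.cast_nonneg (α := ℝ) n)
    (sq_nonneg (centralRatio n))]

theorem tendsto_centralRatio : Tendsto centralRatio atTop (𝓝 0) := by
  have := tendsto_centralRatio_sq.sqrt
  simpa [Real.sqrt_sq (centralRatio_pos _).le] using this

/-- Since `2 (c_n - c_{n+1}) = c_n / (n+1)` dominates `c_n³`, a telescoping series bounds the
partial sums. This gives convergence of the transformation on the circle `|x| = 1`. -/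
theorem summable_centralRatio_cube : Summable fun n => centralRatio n ^ 3 := by
  refine summable_of_sum_range_le (c := 2) (fun n => by have := centralRatio_pos n; positivity) ?_
  suffices h : ∀ N, ∑ n ∈ Finset.range N, centralRatio n ^ 3 ≤ 2 - 2 * centralRatio N from
    fun N => (h N).trans (by linarith [centralRatio_pos N])
  intro N
  induction N with
  | zero => simp [centralRatio_zero]
  | succ n ih =>
    rw [Finset.sum_range_succ, centralRatio_succ]
    have h0 := centralRatio_pos n
    have h1 : centralRatio n ^ 3 ≤ centralRatio n / (n + 1) := by
      rw [le_div_iff₀ (by positivity)]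
      have h2 : (n + 1) * centralRatio n ^ 2 ≤ 1 := by
        nlinarith [mul_centralRatio_sq_le_one n, mul_nonneg (Nat.cast_nonneg (α := ℝ) n)
          (sq_nonneg (centralRatio n))]
      nlinarith
    have h3 : 2 * (centralRatio n * ((2 * n + 1) / (2 * n + 2))) =
        2 * centralRatio n - centralRatio n / (n + 1) := by
      field_simp
      ring
    linarith

theorem ramanujanCoeff_half (n : ℕ) : ramanujanCoeff (1 / 2) n = centralRatio n ^ 3 := by
  rw [ramanujanCoeff, centralRatio, poch_one]
  norm_num
  ring

theorem ramanujanCoeff_sixth (k : ℕ) :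
    ramanujanCoeff (1 / 6) k * 27 ^ k = poch (1 / 2) (3 * k) / k.factorial ^ 3 := by
  rw [ramanujanCoeff, poch_one, poch_half_three_mul]
  norm_num
  ring

theorem hyp3F2Term_half (x : ℂ) (n : ℕ) :
    hyp3F2Term (1 / 2) (1 / 2) (1 / 2) 1 1 x n = (ramanujanCoeff (1 / 2) n : ℂ) * x ^ n := by
  rw [hyp3F2Term, ramanujanCoeff]
  push_cast [poch_ofReal, poch_one]
  norm_num
  ring

theorem hyp3F2Term_sixth (x : ℂ) (n : ℕ) :
    hyp3F2Term (1 / 2) (1 / 6) (5 / 6) 1 1 x n = (ramanujanCoeff (1 / 6) n : ℂ) * x ^ n := by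
  rw [hyp3F2Term, ramanujanCoeff]
  push_cast [poch_ofReal, poch_one]
  norm_num
  ring

/-! ### Summation by WZ pairs -/

/-- If `F` and `G` form a WZ pair whose boundary terms vanish, all the series `∑ n, F n k` have
the same partial-sum limits. -/
theorem tendsto_sum_range_iff_of_wz {F G : ℕ → ℕ → ℝ}
    (wz : ∀ n k, F n (k + 1) - F n k = G (n + 1) k - G n k) (h0 : ∀ k, G 0 k = 0)
    (hG : ∀ k, Tendsto (fun n => G n k) atTop (𝓝 0)) (S : ℝ) (k : ℕ) :
    Tendsto (fun N => ∑ n ∈ Finset.range N, F n k) atTop (𝓝 S) ↔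
      Tendsto (fun N => ∑ n ∈ Finset.range N, F n 0) atTop (𝓝 S) := by
  induction k with
  | zero => rfl
  | succ k ih =>
    rw [← ih]
    have key : ∀ N, ∑ n ∈ Finset.range N, F n (k + 1) =
        ∑ n ∈ Finset.range N, F n k + G N k := by
      intro N
      rw [← sub_eq_iff_eq_add', ← Finset.sum_sub_distrib, Finset.sum_congr rfl fun n _ => wz n k,
        Finset.sum_range_sub (fun n => G n k), h0, sub_zero]
    refine ⟨fun h => ?_, fun h => ?_⟩
    · have := h.sub (hG k)
      simpa [key] using this
    · have := h.add (hG k)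
      simpa [key] using this

/-- Evaluation of the bottom series of a WZ pair by letting the parameter tend to infinity. -/
theorem tendsto_sum_range_of_wz {F G : ℕ → ℕ → ℝ}
    (wz : ∀ n k, F n (k + 1) - F n k = G (n + 1) k - G n k) (h0 : ∀ k, G 0 k = 0)
    (hG : ∀ k, Tendsto (fun n => G n k) atTop (𝓝 0)) {L : ℝ}
    (hL : Tendsto (fun k => F 0 k) atTop (𝓝 L))
    (hF : ∀ n k, |F n k| ≤ 3 * (2 * n + 1) / ((n + k).choose n : ℝ)) :
    Tendsto (fun N => ∑ n ∈ Finset.range N, F n 0) atTop (𝓝 L) := by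
  -- From `k = 3` on the binomial is at least cubic in `n`, so the bound is `O(1/n²)`. One majorant
  -- then serves every `k ≥ 3`, even if the series at `k = 0` converges only conditionally.
  have hb : Summable fun n : ℕ => 3 * (2 * (n : ℝ) + 1) / ((n + 3).choose n : ℝ) := by
    have h2 : Summable fun n : ℕ => 36 * (1 / ((n : ℝ) + 1) ^ 2) := by
      have := (summable_nat_add_iff 1).2 (Real.summable_one_div_nat_pow.2 one_lt_two)
      exact (by simpa using this : Summable fun n : ℕ => 1 / ((n : ℝ) + 1) ^ 2).mul_left 36
    refine h2.of_nonneg_of_le (fun n => by positivity) fun n => ?_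
    have hc : ((n + 3).choose n : ℝ) = (n + 1) * (n + 2) * (n + 3) / 6 := by
      rw [Nat.choose_symm_add, Nat.cast_choose ℝ (by omega), Nat.add_sub_cancel]
      simp only [Nat.factorial_succ, Nat.factorial_zero]
      have : (n.factorial : ℝ) ≠ 0 := by positivity
      push_cast
      field_simp
      ring
    rw [hc, div_le_iff₀ (by positivity)]
    have hn : (0 : ℝ) ≤ n := n.cast_nonneg
    field_simp
    nlinarith
  have hle : ∀ k, 3 ≤ k → ∀ n, ‖F n k‖ ≤ 3 * (2 * (n : ℝ) + 1) / ((n + 3).choose n : ℝ) := by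
    intro k hk n
    refine (hF n k).trans ?_
    have : 0 < (n + 3).choose n := Nat.choose_pos (by omega)
    gcongr
  have hlim : ∀ n, Tendsto (fun k => F n k) atTop (𝓝 (if n = 0 then L else 0)) := by
    intro n
    rcases eq_or_ne n 0 with rfl | hn
    · simpa using hL
    · rw [if_neg hn]
      refine squeeze_zero_norm (hF n) ?_
      refine tendsto_const_nhds.div_atTop ?_
      refine tendsto_atTop_mono (fun k => ?_) tendsto_natCast_atTop_atTop
      obtain ⟨m, rfl⟩ := Nat.exists_eq_succ_of_ne_zero hn
      have : k ≤ (m.succ + k).choose m.succ := by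
        rw [Nat.choose_symm_add]
        calc k ≤ (1 + k).choose k := by rw [add_comm, Nat.choose_succ_self_right]; omega
          _ ≤ _ := Nat.choose_le_choose _ (by omega)
      exact_mod_cast this
  have hd := tendsto_tsum_of_dominated_convergence hb hlim (eventually_atTop.2 ⟨3, hle⟩)
  rw [tsum_ite_eq] at hd
  have hs : ∀ k, 3 ≤ k → Tendsto (fun N => ∑ n ∈ Finset.range N, F n 0) atTop
      (𝓝 (∑' n, F n k)) := fun k hk =>
    (tendsto_sum_range_iff_of_wz wz h0 hG _ k).1
      (hb.of_norm_bounded (hle k hk)).hasSum.tendsto_sum_nat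
  -- The sums do not depend on `k ≥ 3`, so their limit `L` is already their common value.
  have : Tendsto (fun k => ∑' n, F n k) atTop (𝓝 (∑' n, F n 3)) := by
    refine tendsto_const_nhds.congr' (eventually_atTop.2 ⟨3, fun k hk => ?_⟩)
    exact tendsto_nhds_unique (hs 3 le_rfl) (hs k hk)
  rw [← tendsto_nhds_unique this hd]
  exact hs 3 le_rfl

/-! ### Two evaluations: `2/π` and `4/π` -/

/-- The WZ pair is `F = (2n+k+1/2) t`, `G = n t`. At `k = 0`, `F` is half the wanted summand; at `n
= 0` it is `(2k+1) c_k² / 2`, which tends to `1/π` by Wallis. -/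
theorem tendsto_alternating_centralRatio_sum :
    Tendsto (fun N : ℕ => ∑ n ∈ Finset.range N,
      ramanujanCoeff (1 / 2) n * (4 * (n : ℝ) + 1) * (-1 : ℝ) ^ n) atTop (𝓝 (2 / Real.pi)) := by
  let t : ℕ → ℕ → ℝ := fun n k => (-1) ^ n * (poch (1 / 2) (n + k) * poch (1 / 2) k *
    poch (1 / 2) n ^ 2 / (n.factorial * (n + k).factorial ^ 2))
  have hp : ∀ n, 0 < poch (1 / 2 : ℝ) n := poch_pos (by norm_num)
  have hc : ∀ n, poch (1 / 2 : ℝ) n = centralRatio n * n.factorial := fun n => by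
    rw [centralRatio, div_mul_cancel₀ _ (by positivity)]
  have key := tendsto_sum_range_of_wz (F := fun n k => (2 * n + k + 1 / 2) * t n k)
    (G := fun n k => n * t n k) (L := 1 / Real.pi) ?_ (by simp) ?_ ?_ ?_
  · have := key.const_mul 2
    rw [mul_one_div] at this
    refine this.congr fun N => ?_
    rw [Finset.mul_sum]
    refine Finset.sum_congr rfl fun n _ => ?_
    rw [ramanujanCoeff_half]
    simp only [t, add_zero, hc]
    have : (n.factorial : ℝ) ≠ 0 := by positivity
    simp only [Nat.factorial_zero, centralRatio_zero]
    push_cast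
    field_simp
    ring
  · intro n k
    have e1 : n + (k + 1) = n + k + 1 := rfl
    have e2 : n + 1 + k = n + k + 1 := by ring
    simp only [t, e1, e2, poch_succ, pow_succ, Nat.factorial_succ]
    have h1 : (n.factorial : ℝ) ≠ 0 := by positivity
    have h2 : ((n + k).factorial : ℝ) ≠ 0 := by positivity
    have h3 : (n : ℝ) + 1 ≠ 0 := by positivity
    have h4 : (n : ℝ) + k + 1 ≠ 0 := by positivity
    push_cast
    field_simp
    ring
  · intro k
    refine squeeze_zero_norm (fun n => ?_)
      (mul_zero (poch (1 / 2 : ℝ) k) ▸ tendsto_centralRatio.const_mul _)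
    have h0 := centralRatio_pos n
    have hk := hp k
    have hf : (n.factorial : ℝ) ≤ (n + k).factorial := by
      exact_mod_cast Nat.factorial_le (Nat.le_add_right n k)
    have e : ‖(n : ℝ) * t n k‖ = poch (1 / 2) k * ((n * centralRatio n ^ 2) *
        (centralRatio (n + k) * (n.factorial / (n + k).factorial))) := by
      simp only [t, norm_mul, norm_div, norm_pow, norm_neg, norm_one, one_pow, one_mul,
        Real.norm_natCast, Real.norm_of_nonneg (hp _).le]
      rw [hc (n + k), hc n]
      field_simp
    rw [e]
    refine mul_le_mul_of_nonneg_left ?_ hk.le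
    have h1 : n * centralRatio n ^ 2 ≤ 1 := by
      nlinarith [mul_centralRatio_sq_le_one n, mul_nonneg (Nat.cast_nonneg (α := ℝ) n)
        (sq_nonneg (centralRatio n))]
    have h2 : centralRatio (n + k) * (n.factorial / (n + k).factorial) ≤ centralRatio n * 1 := by
      refine mul_le_mul (centralRatio_antitone (Nat.le_add_right n k)) ?_ (by positivity) h0.le
      rw [div_le_one (by positivity)]; exact hf
    have h3 := centralRatio_pos (n + k)
    calc _ ≤ 1 * (centralRatio n * 1) := mul_le_mul h1 h2 (by positivity) zero_le_one
      _ = _ := by ring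
  · have := tendsto_mul_centralRatio_sq.const_mul (1 / 2)
    rw [show 1 / 2 * (2 / Real.pi) = 1 / Real.pi by ring] at this
    refine this.congr fun k => ?_
    simp only [t, hc, zero_add]
    have : (k.factorial : ℝ) ≠ 0 := by positivity
    simp only [Nat.factorial_zero, centralRatio_zero]
    push_cast
    field_simp
    ring
  · intro n k
    have hC : ((n + k).factorial : ℝ) = (n + k).choose n * n.factorial * k.factorial := by
      rw [Nat.choose_symm_add]
      exact_mod_cast (Nat.add_choose_mul_factorial_mul_factorial n k).symm
    have hC0 : (0 : ℝ) < (n + k).choose n := by exact_mod_cast Nat.choose_pos (by omega)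
    have e : |(2 * (n : ℝ) + k + 1 / 2) * t n k| = (2 * n + k + 1 / 2) *
        (centralRatio (n + k) * centralRatio k) * centralRatio n ^ 2 / (n + k).choose n := by
      have : |2 * (n : ℝ) + k + 1 / 2| = 2 * n + k + 1 / 2 := abs_of_nonneg (by positivity)
      simp only [t, abs_mul, abs_div, abs_pow, abs_neg, abs_one, one_pow, one_mul,
        Nat.abs_cast, abs_of_pos (hp _), this]
      rw [hc (n + k), hc n, hc k, hC]
      field_simp
    have h0 := centralRatio_pos k
    have h1 : centralRatio (n + k) * centralRatio k ≤ centralRatio k ^ 2 := by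
      rw [sq]
      exact mul_le_mul_of_nonneg_right (centralRatio_antitone (Nat.le_add_left k n)) h0.le
    have h2 := mul_centralRatio_sq_le_one k
    have h3 : centralRatio n ^ 2 ≤ 1 :=
      pow_le_one₀ (centralRatio_pos n).le (centralRatio_le_one n)
    have hnk : (2 * (n : ℝ) + k + 1 / 2) ≤ 3 * (2 * n + 1) * (2 * k + 1) := by
      have : (0 : ℝ) ≤ n * k := by positivity
      linarith [Nat.cast_nonneg (α := ℝ) n, Nat.cast_nonneg (α := ℝ) k]
    rw [e]
    refine div_le_div_of_nonneg_right ?_ hC0.le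
    have hpos := centralRatio_pos (n + k)
    calc (2 * (n : ℝ) + k + 1 / 2) * (centralRatio (n + k) * centralRatio k) * centralRatio n ^ 2
        ≤ (3 * (2 * n + 1) * (2 * k + 1)) * centralRatio k ^ 2 * 1 := by gcongr
      _ = 3 * (2 * n + 1) * ((2 * k + 1) * centralRatio k ^ 2) := by ring
      _ ≤ 3 * (2 * n + 1) * 1 := by gcongr
      _ = _ := mul_one _

theorem hasSum_six_mul_add_one :
    HasSum (fun n : ℕ => ramanujanCoeff (1 / 2) n * (6 * (n : ℝ) + 1) * (1 / 4 : ℝ) ^ n)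
      (4 / Real.pi) := by
  let t : ℕ → ℕ → ℝ := fun n k => (1 / 4) ^ n * (poch (1 / 2) n ^ 3 * poch (1 / 2) k ^ 2 /
    (n.factorial * (n + k).factorial ^ 2))
  have hp : ∀ n, 0 < poch (1 / 2 : ℝ) n := poch_pos (by norm_num)
  have hc : ∀ n, poch (1 / 2 : ℝ) n = centralRatio n * n.factorial := fun n => by
    rw [centralRatio, div_mul_cancel₀ _ (by positivity)]
  have h4 : ∀ n : ℕ, (1 / 4 : ℝ) ^ n ≤ 1 := fun n => pow_le_one₀ (by norm_num) (by norm_num)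
  have ht : ∀ n k, 0 < t n k := fun n k => by
    have := hp n; have := hp k
    positivity
  have key := tendsto_sum_range_of_wz (F := fun n k => (6 * n + 1 + 4 * k) * t n k)
    (G := fun n k => 8 * n * t n k) (L := 4 / Real.pi) ?_ (by simp) ?_ ?_ ?_
  · rw [hasSum_iff_tendsto_nat_of_nonneg]
    · refine key.congr fun N => Finset.sum_congr rfl fun n _ => ?_
      rw [ramanujanCoeff_half]
      simp only [t, add_zero, hc]
      have : (n.factorial : ℝ) ≠ 0 := by positivity
      simp only [Nat.factorial_zero, centralRatio_zero]
      push_cast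
      field_simp
      ring
    · intro n
      rw [ramanujanCoeff_half]
      have := centralRatio_pos n
      positivity
  · intro n k
    have e1 : n + (k + 1) = n + k + 1 := rfl
    have e2 : n + 1 + k = n + k + 1 := by ring
    simp only [t, e1, e2, poch_succ, pow_succ, Nat.factorial_succ]
    have h1 : (n.factorial : ℝ) ≠ 0 := by positivity
    have h2 : ((n + k).factorial : ℝ) ≠ 0 := by positivity
    have h3 : (n : ℝ) + 1 ≠ 0 := by positivity
    have h4 : (n : ℝ) + k + 1 ≠ 0 := by positivity
    push_cast
    field_simp
    ring
  · intro k
    refine squeeze_zero_norm (fun n => ?_)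
      (mul_zero (8 * poch (1 / 2 : ℝ) k ^ 2) ▸ tendsto_centralRatio.const_mul _)
    have h0 := centralRatio_pos n
    have hf : (n.factorial : ℝ) / (n + k).factorial ≤ 1 := by
      rw [div_le_one (by positivity)]
      exact_mod_cast Nat.factorial_le (Nat.le_add_right n k)
    have e : ‖8 * (n : ℝ) * t n k‖ = 8 * poch (1 / 2) k ^ 2 * ((n * centralRatio n ^ 2) *
        ((1 / 4) ^ n * (n.factorial / (n + k).factorial) ^ 2) * centralRatio n) := by
      rw [Real.norm_of_nonneg (mul_nonneg (by positivity) (ht n k).le)]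
      simp only [t]
      rw [hc n]
      field_simp
    rw [e]
    refine mul_le_mul_of_nonneg_left ?_ (by positivity)
    have h1 : n * centralRatio n ^ 2 ≤ 1 := by
      nlinarith [mul_centralRatio_sq_le_one n, mul_nonneg (Nat.cast_nonneg (α := ℝ) n)
        (sq_nonneg (centralRatio n))]
    refine mul_le_of_le_one_left h0.le (mul_le_one₀ h1 (by positivity) ?_)
    exact mul_le_one₀ (h4 n) (by positivity) (pow_le_one₀ (by positivity) hf)
  -- `F 0 k = (4k+1) c_k² = 2 (2k+1) c_k² - c_k²`.
  · have := (tendsto_mul_centralRatio_sq.const_mul 2).sub tendsto_centralRatio_sq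
    rw [show 2 * (2 / Real.pi) - 0 = 4 / Real.pi by ring] at this
    refine this.congr fun k => ?_
    simp only [t, hc, zero_add]
    have : (k.factorial : ℝ) ≠ 0 := by positivity
    simp only [Nat.factorial_zero, centralRatio_zero]
    push_cast
    field_simp
    ring
  · intro n k
    have hC : ((n + k).factorial : ℝ) = (n + k).choose n * n.factorial * k.factorial := by
      rw [Nat.choose_symm_add]
      exact_mod_cast (Nat.add_choose_mul_factorial_mul_factorial n k).symm
    have hC1 : (1 : ℝ) ≤ (n + k).choose n := by exact_mod_cast Nat.choose_pos (by omega)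
    have e : |(6 * (n : ℝ) + 1 + 4 * k) * t n k| = (6 * n + 1 + 4 * k) * centralRatio k ^ 2 *
        ((1 / 4) ^ n * centralRatio n ^ 3 * (1 / (n + k).choose n)) / (n + k).choose n := by
      rw [abs_of_nonneg (mul_nonneg (by positivity) (ht n k).le)]
      simp only [t]
      rw [hc n, hc k, hC]
      field_simp
    have h0 := centralRatio_pos n
    have h2 := mul_centralRatio_sq_le_one k
    have h3 : (1 / 4 : ℝ) ^ n * centralRatio n ^ 3 * (1 / (n + k).choose n) ≤ 1 := by
      refine mul_le_one₀ (mul_le_one₀ (h4 n) (by positivity)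
        (pow_le_one₀ h0.le (centralRatio_le_one n))) (by positivity) ?_
      rw [div_le_one (by positivity)]; exact hC1
    have hnk : (6 * (n : ℝ) + 1 + 4 * k) ≤ 3 * (2 * n + 1) * (2 * k + 1) := by
      have : (0 : ℝ) ≤ n * k := by positivity
      linarith [Nat.cast_nonneg (α := ℝ) n, Nat.cast_nonneg (α := ℝ) k]
    rw [e]
    refine div_le_div_of_nonneg_right ?_ (by positivity)
    calc (6 * (n : ℝ) + 1 + 4 * k) * centralRatio k ^ 2 *
          ((1 / 4) ^ n * centralRatio n ^ 3 * (1 / (n + k).choose n))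
        ≤ (3 * (2 * n + 1) * (2 * k + 1)) * centralRatio k ^ 2 * 1 := by gcongr
      _ = 3 * (2 * n + 1) * ((2 * k + 1) * centralRatio k ^ 2) := by ring
      _ ≤ 3 * (2 * n + 1) * 1 := by gcongr
      _ = _ := mul_one _

/-! ### The terminating sum behind the transformation -/

/-- The summand `(1/2)_{n+k} / (k!³ (n-2k)! 4^{n+k})`, which vanishes for `n < 2 k`. -/
noncomputable def cubicSummand (n k : ℕ) : ℝ :=
  poch (1 / 2) (n + k) / (k.factorial ^ 3 * 4 ^ (n + k)) *
    (n.descFactorial (2 * k) / n.factorial)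

theorem cubicSummand_nonneg (n k : ℕ) : 0 ≤ cubicSummand n k := by
  have := poch_pos (a := 1 / 2) (by norm_num) (n + k)
  unfold cubicSummand
  positivity

theorem cubicSummand_of_lt {n k : ℕ} (h : n < 2 * k) : cubicSummand n k = 0 := by
  simp [cubicSummand, Nat.descFactorial_of_lt h]

theorem cubicSummand_add (m k : ℕ) :
    cubicSummand (m + 2 * k) k = poch (1 / 2) (3 * k) / (k.factorial ^ 3 * 64 ^ k) *
      (poch (3 * (k : ℝ) + 1 / 2) m / (m.factorial * 4 ^ m)) := by
  have h1 : ((m + 2 * k).descFactorial (2 * k) : ℝ) / (m + 2 * k).factorial =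
      1 / m.factorial := by
    have := Nat.factorial_mul_descFactorial (Nat.le_add_left (2 * k) m)
    rw [Nat.add_sub_cancel] at this
    rw [← this]
    have hd : (m + 2 * k).descFactorial (2 * k) ≠ 0 := by
      rw [Ne, Nat.descFactorial_eq_zero_iff_lt]; omega
    push_cast
    field_simp
  rw [cubicSummand, h1, show m + 2 * k + k = 3 * k + m by ring, poch_add, pow_add, pow_mul]
  rw [show (4 : ℝ) ^ 3 = 64 by norm_num, add_comm (1 / 2 : ℝ)]
  push_cast
  ring

/-- This is `(n+1-2k)/(n+1-2k)! = 1/(n-2k)!`, also valid for `n < 2k`, where both sides vanish;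
later algebra then needs no case split. -/
theorem succ_sub_mul_descFactorial (n k : ℕ) :
    ((n : ℝ) + 1 - 2 * k) * ((n + 1).descFactorial (2 * k) / (n + 1).factorial) =
      n.descFactorial (2 * k) / n.factorial := by
  have h : ((n : ℝ) + 1 - 2 * k) * (n + 1).descFactorial (2 * k) =
      (n + 1) * n.descFactorial (2 * k) := by
    have := Nat.succ_descFactorial n (2 * k)
    rcases le_or_gt (2 * k) (n + 1) with hk | hk
    · have h2 := congrArg (Nat.cast : ℕ → ℝ) this
      push_cast [Nat.cast_sub hk] at h2
      linarith
    · rw [Nat.descFactorial_of_lt hk, Nat.descFactorial_of_lt (by omega)]; simp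
  rw [Nat.factorial_succ]
  push_cast
  field_simp
  linarith

theorem descFactorial_two_mul_succ (n k : ℕ) :
    ((n + 1).descFactorial (2 * (k + 1)) : ℝ) =
      (n + 1 - 2 * k) * (n - 2 * k) * (n + 1).descFactorial (2 * k) := by
  have aux : ∀ a b : ℕ, ((a.descFactorial (b + 1) : ℕ) : ℝ) = (a - b) * a.descFactorial b := by
    intro a b
    rw [Nat.descFactorial_succ]
    rcases le_or_gt b a with h | h
    · push_cast [Nat.cast_sub h]; ring
    · rw [Nat.descFactorial_of_lt h]; simp
  rw [show 2 * (k + 1) = 2 * k + 1 + 1 by ring, aux, aux]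
  push_cast
  ring

theorem sum_cubicSummand_succ (n : ℕ) {N : ℕ} (hN : n + 1 < 2 * N) :
    (n + 1 : ℝ) ^ 3 * ∑ k ∈ Finset.range N, cubicSummand (n + 1) k =
      (n + 1 / 2) ^ 3 * ∑ k ∈ Finset.range N, cubicSummand n k := by
  -- Telescoping certificate for the recurrence in `n`: it vanishes at `k = 0` through `k³`, and at
  -- `k = N` because `2N > n+1`.
  let G : ℕ → ℝ := fun k => -(3 * n + 2) * k ^ 3 * (poch (1 / 2) (n + k) /
    (k.factorial ^ 3 * 4 ^ (n + k)) * ((n + 1).descFactorial (2 * k) / (n + 1).factorial))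
  have wz : ∀ k, (n + 1 : ℝ) ^ 3 * cubicSummand (n + 1) k - (n + 1 / 2) ^ 3 * cubicSummand n k =
      G (k + 1) - G k := by
    intro k
    have e1 : n + (k + 1) = n + k + 1 := rfl
    have e2 : n + 1 + k = n + k + 1 := by ring
    simp only [G, cubicSummand, ← succ_sub_mul_descFactorial n k, descFactorial_two_mul_succ,
      e1, e2, poch_succ, pow_succ, Nat.factorial_succ k]
    push_cast
    field_simp
    ring
  rw [← sub_eq_zero, Finset.mul_sum, Finset.mul_sum, ← Finset.sum_sub_distrib,
    Finset.sum_congr rfl fun k _ => wz k, Finset.sum_range_sub]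
  simp [G, Nat.descFactorial_of_lt hN]

/-- The terminating Saalschützian sum behind the cubic transformation. -/
theorem sum_cubicSummand (n : ℕ) {N : ℕ} (hN : n < 2 * N) :
    ∑ k ∈ Finset.range N, cubicSummand n k = centralRatio n ^ 3 := by
  induction n with
  | zero =>
    rw [Finset.sum_eq_single_of_mem 0 (Finset.mem_range.2 (by omega))
      fun k _ hk => cubicSummand_of_lt (by omega)]
    simp [cubicSummand, centralRatio_zero, poch_zero]
  | succ n ih =>
    have h := sum_cubicSummand_succ n hN
    rw [ih (by omega)] at h
    rw [centralRatio_succ]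
    have : (n : ℝ) + 1 ≠ 0 := by positivity
    have h3 : (n + 1 : ℝ) ^ 3 ≠ 0 := by positivity
    apply mul_left_cancel₀ h3
    rw [h]
    field_simp

theorem hasSum_cubicSummand (n : ℕ) : HasSum (cubicSummand n) (ramanujanCoeff (1 / 2) n) := by
  rw [ramanujanCoeff_half, ← sum_cubicSummand n (N := n + 1) (by omega)]
  refine hasSum_sum_of_ne_finset_zero fun k hk => cubicSummand_of_lt ?_
  simp only [Finset.mem_range, not_lt] at hk
  omega

/-! ### Binomial series and the cubic transformation -/

theorem HasSum.of_eq {ι M : Type*} [AddCommMonoid M] [TopologicalSpace M] {f g : ι → M}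
    {a b : M} (h : HasSum f a)
    (hfg : ∀ i, g i = f i) (hab : b = a) : HasSum g b := by
  rw [hab, show g = f from funext hfg]
  exact h

theorem hasSum_poch_mul_pow (s : ℂ) {y : ℂ} (hy : ‖y‖ < 1) :
    HasSum (fun m : ℕ => poch s m / m.factorial * y ^ m) ((1 - y) ^ (-s)) := by
  have h := (Complex.one_div_one_sub_cpow_hasFPowerSeriesOnBall_zero s).hasSum
    (y := y) (by simpa [enorm_eq_nnnorm, ← NNReal.coe_lt_coe] using hy)
  simp only [zero_add, FormalMultilinearSeries.ofScalars_apply_eq, smul_eq_mul, one_div,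
    ← Complex.cpow_neg] at h
  refine h.of_eq (fun m => ?_) rfl
  congr 1
  have := Ring.factorial_nsmul_multichoose_eq_ascPochhammer s m
  rw [Ring.multichoose_eq, Polynomial.ascPochhammer_smeval_eq_eval, nsmul_eq_mul] at this
  rw [poch, ← this]
  have : (m.factorial : ℂ) ≠ 0 := by exact_mod_cast m.factorial_ne_zero
  field_simp

/-- The binomial series weighted by a linear polynomial in the index. -/
theorem hasSum_linear_mul_poch_mul_pow (s a b : ℂ) {y : ℂ} (hy : ‖y‖ < 1) :
    HasSum (fun m : ℕ => (a * m + b) * (poch s m / m.factorial * y ^ m))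
      ((1 - y) ^ (-s) * (a * (s * (y / (1 - y))) + b)) := by
  have h1y : 1 - y ≠ 0 := by
    intro h
    rw [← sub_eq_zero.1 h] at hy
    simp at hy
  have h1 : HasSum (fun m : ℕ => (m : ℂ) * (poch s m / m.factorial * y ^ m))
      ((1 - y) ^ (-s) * (s * (y / (1 - y)))) := by
    rw [← hasSum_nat_add_iff' 1]
    simp only [Finset.sum_range_one, Nat.cast_zero, zero_mul, sub_zero]
    -- Uses `m (s)_m / m! = s (s+1)_{m-1} / (m-1)!`.
    have h := (hasSum_poch_mul_pow (s + 1) hy).mul_left (s * y)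
    have e : (1 - y) ^ (-s) * (s * (y / (1 - y))) = s * y * (1 - y) ^ (-(s + 1)) := by
      rw [neg_add, Complex.cpow_add _ _ h1y, Complex.cpow_neg_one]
      field_simp
    rw [e]
    refine h.of_eq (fun m => ?_) rfl
    rw [poch_succ_left, Nat.factorial_succ]
    have : (m.factorial : ℂ) ≠ 0 := by exact_mod_cast m.factorial_ne_zero
    have : (m : ℂ) + 1 ≠ 0 := by exact_mod_cast m.succ_ne_zero
    push_cast
    field_simp
    ring
  have h2 := (h1.mul_left a).add ((hasSum_poch_mul_pow s hy).mul_left b)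
  rw [show (1 - y) ^ (-s) * (a * (s * (y / (1 - y))) + b) =
    a * ((1 - y) ^ (-s) * (s * (y / (1 - y)))) + b * (1 - y) ^ (-s) by ring]
  simpa only [add_mul, mul_assoc] using h2

/-- The sum over `n` of the cubic summands weighted by a linear polynomial. -/
theorem hasSum_cubicSummand_mul_pow (a b : ℂ) {x : ℂ} (hx : ‖x‖ < 4) (k : ℕ) :
    HasSum (fun n : ℕ => (cubicSummand n k : ℂ) * ((a * n + b) * x ^ n))
      ((1 - x / 4) ^ (-(1 / 2) : ℂ) * ((ramanujanCoeff (1 / 6) k : ℂ) *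
        (a * (k * ((8 + x) / (4 - x)) + x / (2 * (4 - x))) + b) *
        (27 * x ^ 2 / (4 - x) ^ 3) ^ k)) := by
  have h4 : 4 - x ≠ 0 := by
    intro h
    rw [← sub_eq_zero.1 h] at hx
    simp at hx
  have hy : ‖x / 4‖ < 1 := by
    rw [norm_div, div_lt_one (by norm_num)]
    simpa using hx
  have h1y : 1 - x / 4 ≠ 0 := by
    rw [show 1 - x / 4 = (4 - x) / 4 by ring]
    exact div_ne_zero h4 (by norm_num)
  rw [← hasSum_nat_add_iff' (2 * k), Finset.sum_eq_zero fun n hn => by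
    rw [cubicSummand_of_lt (Finset.mem_range.1 hn)]; simp, sub_zero]
  -- With `n = m + 2k` the weight `a n + b` becomes `a m + (2ak + b)`.
  have h := (hasSum_linear_mul_poch_mul_pow (3 * k + 1 / 2) a (a * (2 * k) + b) hy).mul_left
    ((ramanujanCoeff (1 / 6) k : ℂ) * 27 ^ k / 64 ^ k * x ^ (2 * k))
  refine h.of_eq (fun m => ?_) ?_
  · rw [cubicSummand_add]
    have hr := congrArg (Complex.ofReal) (ramanujanCoeff_sixth k)
    push_cast at hr
    push_cast [poch_ofReal] at hr ⊢
    rw [hr, div_pow]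
    ring
  · have e1 : (1 - x / 4) ^ (-(3 * (k : ℂ) + 1 / 2)) =
        (1 - x / 4) ^ (-(1 / 2) : ℂ) * (64 ^ k / ((4 - x) ^ 3) ^ k) := by
      rw [neg_add, add_comm, Complex.cpow_add _ _ h1y,
        show -(3 * (k : ℂ)) = -((3 * k : ℕ) : ℂ) by push_cast; ring, Complex.cpow_neg _ ((3 * k : ℕ) : ℂ),
        Complex.cpow_natCast, pow_mul, show 1 - x / 4 = (4 - x) / 4 by ring, ← inv_pow,
        div_pow, inv_div, div_pow]
      norm_num
    have e2 : x / 4 / (1 - x / 4) = x / (4 - x) := by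
      rw [show 1 - x / 4 = (4 - x) / 4 by ring]
      field_simp
    rw [e1, e2, div_pow, mul_pow, ← pow_mul x]
    have e3 : a * (k * ((8 + x) / (4 - x)) + x / (2 * (4 - x))) + b =
        a * ((3 * k + 1 / 2) * (x / (4 - x))) + (a * (2 * k) + b) := by
      field_simp
      ring
    rw [e3]
    have : (64 : ℂ) ^ k ≠ 0 := pow_ne_zero _ (by norm_num)
    field_simp

/-- The cubic transformation, with the terms weighted by a linear polynomial in the index. -/
theorem hasSum_cubic_transformation (a b : ℂ) {x : ℂ} (hx : ‖x‖ < 4)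
    (hs : Summable fun n : ℕ => ramanujanCoeff (1 / 2) n * ‖(a * n + b) * x ^ n‖) :
    HasSum (fun k : ℕ => (ramanujanCoeff (1 / 6) k : ℂ) *
        (a * (k * ((8 + x) / (4 - x)) + x / (2 * (4 - x))) + b) *
        (27 * x ^ 2 / (4 - x) ^ 3) ^ k)
      ((1 - x / 4) ^ (1 / 2 : ℂ) *
        ∑' n : ℕ, (ramanujanCoeff (1 / 2) n : ℂ) * ((a * n + b) * x ^ n)) := by
  have h1y : 1 - x / 4 ≠ 0 := by
    intro h
    rw [show x = 4 by linear_combination -4 * h] at hx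
    simp at hx
  let f : ℕ × ℕ → ℂ := fun p => (cubicSummand p.1 p.2 : ℂ) * ((a * p.1 + b) * x ^ p.1)
  have hrow : ∀ n, HasSum (fun k => f (n, k))
      ((ramanujanCoeff (1 / 2) n : ℂ) * ((a * n + b) * x ^ n)) := fun n =>
    (Complex.hasSum_ofReal.2 (hasSum_cubicSummand n)).mul_right ((a * n + b) * x ^ n)
  -- Nonnegativity of the summands means taking norms loses nothing in the row sums, so `hs` is
  -- exactly absolute convergence of the double series.
  have hnorm : ∀ n, HasSum (fun k => ‖f (n, k)‖)
      (ramanujanCoeff (1 / 2) n * ‖(a * n + b) * x ^ n‖) := by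
    intro n
    simpa only [f, norm_mul, Complex.norm_real, Real.norm_of_nonneg (cubicSummand_nonneg _ _)]
      using (hasSum_cubicSummand n).mul_right ‖(a * (n : ℂ) + b) * x ^ n‖
  have hf : Summable f := by
    refine Summable.of_norm ?_
    rw [summable_prod_of_nonneg fun p => norm_nonneg _]
    exact ⟨fun n => (hnorm n).summable, by simpa only [(hnorm _).tsum_eq] using hs⟩
  have hF := hf.hasSum
  have h1 : HasSum (fun n : ℕ => (ramanujanCoeff (1 / 2) n : ℂ) * ((a * n + b) * x ^ n))
      (∑' p, f p) := hF.prod_fiberwise hrow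
  rw [h1.tsum_eq]
  have hF' : HasSum (fun p : ℕ × ℕ => f (p.2, p.1)) (∑' p, f p) :=
    (Equiv.prodComm ℕ ℕ).hasSum_iff.2 hF
  have h2 := (hF'.prod_fiberwise fun k => hasSum_cubicSummand_mul_pow a b hx k).mul_left
    ((1 - x / 4) ^ (1 / 2 : ℂ))
  refine h2.of_eq (fun k => ?_) rfl
  rw [← mul_assoc, ← Complex.cpow_add _ _ h1y]
  simp

/-! ### Bounds, and the transformation at real and complex points -/

theorem poch_le_factorial {a : ℝ} (ha : 0 < a) (ha1 : a ≤ 1) (n : ℕ) :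
    poch a n ≤ n.factorial := by
  induction n with
  | zero => simp [poch_zero]
  | succ n ih =>
    have := poch_pos ha n
    rw [poch_succ, Nat.factorial_succ, mul_comm]
    push_cast
    exact mul_le_mul (by linarith) ih this.le (by positivity)

theorem ramanujanCoeff_pos {s : ℝ} (h0 : 0 < s) (h1 : s < 1) (n : ℕ) :
    0 < ramanujanCoeff s n := by
  have h2 := poch_pos (a := 1 / 2) (by norm_num) n
  have h3 := poch_pos h0 n
  have h4 := poch_pos (sub_pos.2 h1) n
  have h5 := poch_pos (a := (1 : ℝ)) one_pos n
  unfold ramanujanCoeff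
  positivity

theorem ramanujanCoeff_le_one {s : ℝ} (h0 : 0 < s) (h1 : s < 1) (n : ℕ) :
    ramanujanCoeff s n ≤ 1 := by
  have h3 := poch_pos h0 n
  have h4 := poch_pos (sub_pos.2 h1) n
  rw [ramanujanCoeff, poch_one, div_le_one (by positivity), pow_succ, sq]
  have hle : ∀ {a : ℝ}, 0 < a → a ≤ 1 → poch a n ≤ n.factorial :=
    fun ha ha1 => poch_le_factorial ha ha1 n
  gcongr
  · exact hle (by norm_num) (by norm_num)
  · exact hle h0 h1.le
  · exact hle (by linarith) (by linarith)

theorem summable_linear_mul_geometric (a b : ℝ) {q : ℝ} (h0 : 0 ≤ q) (h1 : q < 1) :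
    Summable fun n : ℕ => (a * n + b) * q ^ n := by
  have hq : ‖q‖ < 1 := by rwa [Real.norm_of_nonneg h0]
  have h2 := ((summable_pow_mul_geometric_of_norm_lt_one 1 hq).mul_left a).add
    ((summable_geometric_of_lt_one h0 h1).mul_left b)
  refine h2.congr fun n => ?_
  ring

theorem hasSum_cubic_transformation_real (a b : ℝ) {r : ℝ} (hr : |r| < 1) :
    HasSum (fun k : ℕ => ramanujanCoeff (1 / 6) k *
        (a * (k * ((8 + r) / (4 - r)) + r / (2 * (4 - r))) + b) *
        (27 * r ^ 2 / (4 - r) ^ 3) ^ k)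
      (√(1 - r / 4) * ∑' n : ℕ, ramanujanCoeff (1 / 2) n * ((a * n + b) * r ^ n)) := by
  have hs : Summable fun n : ℕ =>
      ramanujanCoeff (1 / 2) n * ‖((a : ℂ) * n + b) * (r : ℂ) ^ n‖ := by
    refine (summable_linear_mul_geometric |a| |b| (abs_nonneg r) hr).of_nonneg_of_le
      (fun n => mul_nonneg (ramanujanCoeff_pos (by norm_num) (by norm_num) n).le (norm_nonneg _))
      fun n => ?_
    refine (mul_le_of_le_one_left (norm_nonneg _)
      (ramanujanCoeff_le_one (by norm_num) (by norm_num) n)).trans ?_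
    rw [norm_mul, norm_pow, Complex.norm_real, Real.norm_eq_abs]
    refine mul_le_mul_of_nonneg_right ((norm_add_le _ _).trans ?_) (by positivity)
    simp
  have h := hasSum_cubic_transformation a b (x := r) (by
    rw [Complex.norm_real, Real.norm_eq_abs]; linarith) hs
  rw [← Complex.hasSum_ofReal]
  refine h.of_eq (fun k => by push_cast; rfl) ?_
  have h0 : 0 ≤ 1 - r / 4 := by linarith [(abs_lt.1 hr).2]
  rw [Real.sqrt_eq_rpow, Complex.ofReal_mul, Complex.ofReal_cpow h0, Complex.ofReal_tsum]
  push_cast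
  rfl

theorem hyp3F2_cubic_transformation {x : ℂ} (hx : ‖x‖ ≤ 1) :
    Summable (hyp3F2Term (1 / 2) (1 / 2) (1 / 2) 1 1 x) ∧
    Summable (hyp3F2Term (1 / 2) (1 / 6) (5 / 6) 1 1 (27 * x ^ 2 / (4 - x) ^ 3)) ∧
    ∑' n : ℕ, hyp3F2Term (1 / 2) (1 / 2) (1 / 2) 1 1 x n =
      (1 - x / 4) ^ (-(1 / 2) : ℂ) *
        ∑' n : ℕ, hyp3F2Term (1 / 2) (1 / 6) (5 / 6) 1 1 (27 * x ^ 2 / (4 - x) ^ 3) n := by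
  have h1y : 1 - x / 4 ≠ 0 := by
    intro h
    rw [show x = 4 by linear_combination -4 * h] at hx
    norm_num at hx
  have hA : Summable (ramanujanCoeff (1 / 2)) := by
    simpa only [← ramanujanCoeff_half] using summable_centralRatio_cube
  have hpos : ∀ n, 0 ≤ ramanujanCoeff (1 / 2) n := fun n =>
    (ramanujanCoeff_pos (by norm_num) (by norm_num) n).le
  have hs : Summable fun n : ℕ => ramanujanCoeff (1 / 2) n * ‖x ^ n‖ := by
    refine hA.of_nonneg_of_le (fun n => mul_nonneg (hpos n) (norm_nonneg _)) fun n => ?_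
    rw [norm_pow]
    exact mul_le_of_le_one_right (hpos n) (pow_le_one₀ (norm_nonneg _) hx)
  have h := hasSum_cubic_transformation 0 1 (x := x) (by linarith) (by simpa using hs)
  simp only [zero_mul, zero_add, mul_one, one_mul, ← hyp3F2Term_half, ← hyp3F2Term_sixth] at h
  refine ⟨Summable.of_norm ?_, h.summable, ?_⟩
  · simpa only [hyp3F2Term_half, norm_mul, Complex.norm_real, Real.norm_of_nonneg (hpos _)]
      using hs
  · rw [h.tsum_eq, ← mul_assoc, ← Complex.cpow_add _ _ h1y]
    simp

/-! ### Translation of the series at `x = 1/4` and `x = -1` -/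

theorem hasSum_translation_quarter {S : ℝ}
    (h : HasSum (fun n : ℕ => ramanujanCoeff (1 / 2) n * (6 * (n : ℝ) + 1) * (1 / 4 : ℝ) ^ n) S) :
    HasSum (fun n : ℕ => ramanujanCoeff (1 / 6) n * (22 * (n : ℝ) + 2) * (4 / 125 : ℝ) ^ n)
      (5 * √15 / 12 * S) := by
  -- The new weight is `6 (11k/5 + 1/30) + 1 = (3/5)(22k + 2)`, hence the factor `5/3`.
  have h2 := (hasSum_cubic_transformation_real 6 1 (r := 1 / 4)
    (by rw [abs_of_pos] <;> norm_num)).mul_left (5 / 3)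
  simp only [← mul_assoc, h.tsum_eq] at h2
  have e : √(1 - 1 / 4 / 4 : ℝ) = √15 / 4 := by
    rw [show (1 - 1 / 4 / 4 : ℝ) = 15 / 4 ^ 2 by norm_num, Real.sqrt_div (by norm_num),
      Real.sqrt_sq (by norm_num)]
  rw [e] at h2
  refine h2.of_eq (fun k => ?_) (by ring)
  norm_num
  ring

/-- Apply the transformation at `x = -q` and let `q → 1⁻`: Abel's theorem handles the left side,
dominated convergence the right. -/
theorem hasSum_translation_neg_one {S : ℝ}
    (h : Tendsto (fun N : ℕ => ∑ n ∈ Finset.range N,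
      ramanujanCoeff (1 / 2) n * (4 * (n : ℝ) + 1) * (-1 : ℝ) ^ n) atTop (𝓝 S)) :
    HasSum (fun n : ℕ => ramanujanCoeff (1 / 6) n * (28 * (n : ℝ) + 3) * (27 / 125 : ℝ) ^ n)
      (5 * √5 / 2 * S) := by
  let f : ℝ → ℕ → ℝ := fun q k => ramanujanCoeff (1 / 6) k *
    (4 * (k * ((8 - q) / (4 + q)) - q / (2 * (4 + q))) + 1) * (27 * q ^ 2 / (4 + q) ^ 3) ^ k
  have hB : ∀ k, 0 < ramanujanCoeff (1 / 6) k :=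
    ramanujanCoeff_pos (by norm_num) (by norm_num)
  have hB1 : ∀ k, ramanujanCoeff (1 / 6) k ≤ 1 :=
    ramanujanCoeff_le_one (by norm_num) (by norm_num)
  have hbound : ∀ q : ℝ, 0 < q → q ≤ 1 → ∀ k, ‖f q k‖ ≤ (8 * (k : ℝ) + 1) * (27 / 64) ^ k := by
    intro q h0 h1 k
    have hz : 27 * q ^ 2 / (4 + q) ^ 3 ≤ 27 / 64 := by
      have h2 : q ^ 2 ≤ 1 := pow_le_one₀ h0.le h1
      have h3 : (4 : ℝ) ^ 3 ≤ (4 + q) ^ 3 := by gcongr; linarith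
      rw [div_le_div_iff₀ (by positivity) (by norm_num)]
      linarith
    have h4 : (8 - q) / (4 + q) ≤ 2 := by rw [div_le_iff₀ (by linarith)]; linarith
    have h5 : 0 ≤ (8 - q) / (4 + q) := div_nonneg (by linarith) (by linarith)
    have h6 : q / (2 * (4 + q)) ≤ 1 / 4 := by rw [div_le_iff₀ (by linarith)]; linarith
    have h7 : 0 ≤ q / (2 * (4 + q)) := by positivity
    have hk : (0 : ℝ) ≤ k := k.cast_nonneg
    have h8 : (k : ℝ) * ((8 - q) / (4 + q)) ≤ k * 2 := mul_le_mul_of_nonneg_left h4 hk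
    have h9 : 0 ≤ (k : ℝ) * ((8 - q) / (4 + q)) := mul_nonneg hk h5
    have h10 : 0 ≤ 4 * (k * ((8 - q) / (4 + q)) - q / (2 * (4 + q))) + 1 := by linarith
    rw [Real.norm_of_nonneg (mul_nonneg (mul_nonneg (hB k).le h10) (by positivity))]
    refine mul_le_mul ?_ (pow_le_pow_left₀ (by positivity) hz k) (by positivity) (by positivity)
    exact (mul_le_of_le_one_left h10 (hB1 k)).trans (by linarith)
  have hsum := summable_linear_mul_geometric 8 1 (q := 27 / 64) (by norm_num) (by norm_num)
  have hmem : ∀ᶠ q : ℝ in 𝓝[<] 1, q ∈ Set.Ioo 0 1 := Ioo_mem_nhdsLT one_pos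
  have hlim : Tendsto (fun q => ∑' k, f q k) (𝓝[<] 1) (𝓝 (∑' k, f 1 k)) := by
    refine tendsto_tsum_of_dominated_convergence hsum (fun k => ?_)
      (hmem.mono fun q hq => hbound q hq.1 hq.2.le)
    have : ContinuousAt (fun q => f q k) 1 := by
      simp only [f]
      fun_prop (disch := norm_num)
    exact this.tendsto.mono_left nhdsWithin_le_nhds
  have habel := Real.tendsto_tsum_powerSeries_nhdsWithin_lt h
  have hsqrt : Tendsto (fun q : ℝ => √(1 + q / 4)) (𝓝[<] 1) (𝓝 (√(1 + 1 / 4))) := by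
    have : Continuous fun q : ℝ => √(1 + q / 4) := by fun_prop
    exact (this.tendsto 1).mono_left nhdsWithin_le_nhds
  have heq : ∀ᶠ q : ℝ in 𝓝[<] 1, √(1 + q / 4) * ∑' n : ℕ,
      ramanujanCoeff (1 / 2) n * (4 * (n : ℝ) + 1) * (-1 : ℝ) ^ n * q ^ n = ∑' k, f q k := by
    refine hmem.mono fun q hq => ?_
    have h2 := hasSum_cubic_transformation_real 4 1 (r := -q)
      (by rw [abs_neg, abs_of_pos hq.1]; exact hq.2)
    have e1 : ∀ k : ℕ, ramanujanCoeff (1 / 6) k *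
        (4 * (k * ((8 + -q) / (4 - -q)) + -q / (2 * (4 - -q))) + 1) *
        (27 * (-q) ^ 2 / (4 - -q) ^ 3) ^ k = f q k := fun k => by
      simp only [f]
      ring
    have e2 : ∀ n : ℕ, ramanujanCoeff (1 / 2) n * ((4 * (n : ℝ) + 1) * (-q) ^ n) =
        ramanujanCoeff (1 / 2) n * (4 * (n : ℝ) + 1) * (-1 : ℝ) ^ n * q ^ n := fun n => by
      rw [neg_pow]
      ring
    rw [show 1 - -q / 4 = 1 + q / 4 by ring] at h2
    simp only [e1, e2] at h2
    exact h2.tsum_eq.symm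
  have hval := tendsto_nhds_unique ((hsqrt.mul habel).congr' heq) hlim
  have e : √(1 + 1 / 4 : ℝ) = √5 / 2 := by
    rw [show (1 + 1 / 4 : ℝ) = 5 / 2 ^ 2 by norm_num, Real.sqrt_div (by norm_num),
      Real.sqrt_sq (by norm_num)]
  -- At `q = 1` the weight is `4 (7k/5 - 1/10) + 1 = (28k + 3)/5`, hence the factor `5`.
  have h1 := ((hsum.of_norm_bounded (hbound 1 one_pos le_rfl)).hasSum).mul_left 5
  rw [← hval, e] at h1
  refine h1.of_eq (fun k => ?_) (by ring)
  simp only [f]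
  norm_num
  ring

theorem mainTheorem7 :
    -- the cubic transformation, on the whole disc of convergence of its left-hand side
    (∀ x : ℂ, ‖x‖ ≤ 1 →
      Summable (hyp3F2Term (1 / 2) (1 / 2) (1 / 2) 1 1 x) ∧
      Summable (hyp3F2Term (1 / 2) (1 / 6) (5 / 6) 1 1 (27 * x ^ 2 / (4 - x) ^ 3)) ∧
      ∑' n : ℕ, hyp3F2Term (1 / 2) (1 / 2) (1 / 2) 1 1 x n =
        (1 - x / 4) ^ (-(1 / 2) : ℂ) *
          ∑' n : ℕ, hyp3F2Term (1 / 2) (1 / 6) (5 / 6) 1 1 (27 * x ^ 2 / (4 - x) ^ 3) n) ∧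
    -- its translation of the `6 n + 1` series, at `x = 1 / 4`
    (∀ S : ℝ,
      HasSum (fun n : ℕ => ramanujanCoeff (1 / 2) n * (6 * (n : ℝ) + 1) * (1 / 4 : ℝ) ^ n) S ↔
      HasSum (fun n : ℕ => ramanujanCoeff (1 / 6) n * (22 * (n : ℝ) + 2) * (4 / 125 : ℝ) ^ n)
        (5 * √15 / 12 * S)) ∧
    -- its translation of the `28 n + 3` series, at `x = -1`
    (∀ S : ℝ,
      Tendsto (fun N : ℕ => ∑ n ∈ Finset.range N,
        ramanujanCoeff (1 / 2) n * (4 * (n : ℝ) + 1) * (-1 : ℝ) ^ n) atTop (𝓝 S) ↔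
      HasSum (fun n : ℕ => ramanujanCoeff (1 / 6) n * (28 * (n : ℝ) + 3) * (27 / 125 : ℝ) ^ n)
        (5 * √5 / 2 * S)) ∧
    -- the equivalence of the two summations
    (HasSum (fun n : ℕ => ramanujanCoeff (1 / 2) n * (6 * (n : ℝ) + 1) * (1 / 4 : ℝ) ^ n)
        (4 / Real.pi) ↔
      HasSum (fun n : ℕ => ramanujanCoeff (1 / 6) n * (28 * (n : ℝ) + 3) * (27 / 125 : ℝ) ^ n)
        (5 * √5 / Real.pi)) ∧
    -- both summations hold
    HasSum (fun n : ℕ => ramanujanCoeff (1 / 6) n * (28 * (n : ℝ) + 3) * (27 / 125 : ℝ) ^ n)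
      (5 * √5 / Real.pi) ∧
    HasSum (fun n : ℕ => ramanujanCoeff (1 / 2) n * (6 * (n : ℝ) + 1) * (1 / 4 : ℝ) ^ n)
      (4 / Real.pi) := by
  have hP := hasSum_six_mul_add_one
  have hQ : HasSum (fun n : ℕ => ramanujanCoeff (1 / 6) n * (28 * (n : ℝ) + 3) *
      (27 / 125 : ℝ) ^ n) (5 * √5 / Real.pi) := by
    have h := hasSum_translation_neg_one tendsto_alternating_centralRatio_sum
    rwa [show 5 * √5 / 2 * (2 / Real.pi) = 5 * √5 / Real.pi by ring] at h
  refine ⟨fun x hx => hyp3F2_cubic_transformation hx, fun S => ⟨hasSum_translation_quarter, ?_⟩,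
    fun S => ⟨hasSum_translation_neg_one, ?_⟩, ⟨fun _ => hQ, fun _ => hP⟩, hQ, hP⟩
  -- The translated series has a known sum, so uniqueness and cancellation of the nonzero constant
  -- force `S = 4/π`.
  · intro h
    have h0 : 5 * √15 / 12 ≠ 0 := by positivity
    rw [mul_left_cancel₀ h0 (h.unique (hasSum_translation_quarter hP))]
    exact hP
  · intro h
    have h0 : 5 * √5 / 2 ≠ 0 := by positivity
    rw [mul_left_cancel₀ h0 (h.unique
      (hasSum_translation_neg_one tendsto_alternating_centralRatio_sum))]
    exact tendsto_alternating_centralRatio_sum
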